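/- **Theorem 5.3.** Let $n,m\in\mathbb N$, $A\in\mathbb R^{n\times n}$, $B\in\mathbb R^{n\times m}$. A *$C$-set* is a compact convex set containing the origin; a *proper $C$-set* is a $C$-set containing the origin in its interior. For a set $X\ni 0$ in a Euclidean space, $X^*=\{x:\ y^Tx\le 1\ \ \forall y\in X\}$ is its polar set; $\oplus$ is Minkowski addition; $P_x:\mathbb R^{n+m}\to\mathbb R^n$ is the projection $(x,u)\mapsto x$; and $g_X(y)=\min\{\eta\ge 0:\ y\in\eta X\}$ is the Minkowski function of a proper $C$-set $X$. Assume that $(A,B)$ is strictly stabilizable, i.e. the uncontrollable part of $x^+=Ax+Bu$ (the map induced by $A$ on the quotient of $\mathbb R^n$ by the controllable subspace $\sum_{k\ge 0}\operatorname{range}(A^kB)$) has all its eigenvalues in the open unit disc, and that $\mathcal C$ is a proper $C$-set in $\mathbb R^{n+m}$. Consider the map $$F(\mathcal P)=P_x\left(\mathcal C^*\oplus (A\ B)^T\mathcal P^*\right)^*$$ on the state space $\mathbb S=\{\mathcal P\subseteq\mathbb R^n:\ 0\in\mathcal P,\ \mathcal P^*\text{ is a }C\text{-set}\}$, and the set dynamics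 $\mathcal P_{k+1}=F(\mathcal P_k)$, $\mathcal P_0\in\mathbb S$. 1. There is a unique proper $C$-set $\mathcal P_\infty$ in $\mathbb R^n$ with $\mathcal P_\infty=F(\mathcal P_\infty)$. 2. $F$ maps every element of $\mathbb S$ to a proper $C$-set, $\mathcal P_\infty\in\mathbb S$, and $\mathcal P_\infty$ is an asymptotically stable attractor of the set dynamics on $\mathbb S$ with respect to the Hausdorff distance $H$: for every $\varepsilon>0$ there is $\delta>0$ such that $\mathcal P_0\in\mathbb S$ and $H(\mathcal P_0,\mathcal P_\infty)<\delta$ imply $H(\mathcal P_k,\mathcal P_\infty)<\varepsilon$ for all $k$; and $H(\mathcal P_k,\mathcal P_\infty)\to0$ for all $\mathcal P_0\in\mathbb S$ in some $H$-neighbourhood of $\mathcal P_\infty$. 3. The domain of attraction $\{\mathcal P_0\in\mathbb S:\ H(\mathcal P_k,\mathcal P_\infty)\to 0\}$ is all of $\mathbb S$; the set of the polars $\mathcal P_0^*$ of its elements is the set of all $C$-sets in $\mathbb R^n$. 4. Consequently $V=g_{\mathcal P_\infty}$ solves the fixed point Minkowski–Bellman equation $$V(x)=\min_{u\in\mathbb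 R^m}\ g_{\mathcal C}(x,u)+V(Ax+Bu)\quad\text{for all }x\in\mathbb R^n,\qquad U(x)=\operatorname*{arg\,min}_{u\in\mathbb R^m}\ g_{\mathcal C}(x,u)+V(Ax+Bu),$$ (the minimum being attained), and it is the only $V$ solving it among the Minkowski functions of proper $C$-sets in $\mathbb R^n$. -/

import Mathlib

open Filter Topology
open scoped Pointwise ENNReal

noncomputable section

/-- A `C`-set: compact, convex, containing the origin. -/
def IsCSet {ι : Type*} [Fintype ι] (X : Set (EuclideanSpace ℝ ι)) : Prop :=
  IsCompact X ∧ Convex ℝ X ∧ (0 : EuclideanSpace ℝ ι) ∈ X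

/-- A proper `C`-set: a `C`-set containing the origin in its interior. -/
def IsProperCSet {ι : Type*} [Fintype ι] (X : Set (EuclideanSpace ℝ ι)) : Prop :=
  IsCSet X ∧ (0 : EuclideanSpace ℝ ι) ∈ interior X

/-- The (one-sided) polar set `X* = {x : ∀ y ∈ X, yᵀ x ≤ 1}`. -/
def polarSet {ι : Type*} [Fintype ι] (X : Set (EuclideanSpace ℝ ι)) :
    Set (EuclideanSpace ℝ ι) :=
  {x | ∀ y ∈ X, inner ℝ y x ≤ 1}

/-- The image `M X = {M x : x ∈ X}` of a set under a matrix. -/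
def matImage {ι κ : Type*} [Fintype ι] [DecidableEq ι] [Fintype κ] (M : Matrix κ ι ℝ)
    (X : Set (EuclideanSpace ℝ ι)) : Set (EuclideanSpace ℝ κ) :=
  (fun x => Matrix.toEuclideanLin M x) '' X

/-- The controllable subspace of `x⁺ = A x + B u`: the sum of the ranges of `Aᵏ B`, `k ∈ ℕ`. -/
def controllableSubspace {n m : ℕ} (A : Matrix (Fin n) (Fin n) ℝ) (B : Matrix (Fin n) (Fin m) ℝ) :
    Submodule ℝ (EuclideanSpace ℝ (Fin n)) :=
  ⨆ k : ℕ, LinearMap.range (Matrix.toEuclideanLin (A ^ k * B))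

theorem controllableSubspace_invariant {n m : ℕ} (A : Matrix (Fin n) (Fin n) ℝ)
    (B : Matrix (Fin n) (Fin m) ℝ) :
    controllableSubspace A B ≤
      (controllableSubspace A B).comap (Matrix.toEuclideanLin A) := by
  refine iSup_le fun k => ?_
  rintro _ ⟨u, rfl⟩
  refine Submodule.mem_iSup_of_mem (k + 1) ⟨u, ?_⟩
  simp [Matrix.toLpLin_apply, pow_succ', Matrix.mul_assoc]

/-- The uncontrollable part of the dynamics: the map induced by `A` on the quotient of the state
space by the controllable subspace. -/
def uncontrollablePart {n m : ℕ} (A : Matrix (Fin n) (Fin n) ℝ) (B : Matrix (Fin n) (Fin m) ℝ) :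
    Module.End ℝ (EuclideanSpace ℝ (Fin n) ⧸ controllableSubspace A B) :=
  (controllableSubspace A B).mapQ (controllableSubspace A B) (Matrix.toEuclideanLin A)
    (controllableSubspace_invariant A B)

/-- `(A, B)` is strictly stabilizable: the uncontrollable part is strictly stable, that is, all its
(complex) eigenvalues lie in the open unit disc. -/
def IsStrictlyStabilizable {n m : ℕ} (A : Matrix (Fin n) (Fin n) ℝ)
    (B : Matrix (Fin n) (Fin m) ℝ) : Prop :=
  ∀ z : ℂ, Polynomial.aeval z (uncontrollablePart A B).charpoly = 0 → ‖z‖ < 1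

/-- The set dynamics `P ↦ P_x (C* ⊕ (A B)ᵀ P*)*`, where `P_x = (I O)` is the projection
`(x, u) ↦ x`. -/
def setDynamics {n m : ℕ} (A : Matrix (Fin n) (Fin n) ℝ) (B : Matrix (Fin n) (Fin m) ℝ)
    (C : Set (EuclideanSpace ℝ (Fin n ⊕ Fin m))) (P : Set (EuclideanSpace ℝ (Fin n))) :
    Set (EuclideanSpace ℝ (Fin n)) :=
  matImage (Matrix.fromCols (1 : Matrix (Fin n) (Fin n) ℝ) (0 : Matrix (Fin n) (Fin m) ℝ))
    (polarSet (polarSet C + matImage (Matrix.fromCols A B).transpose (polarSet P)))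

/-- The states of the set dynamics: the sets, containing the origin, whose polar is a `C`-set.
Unbounded sets such as the whole space (polar `{0}`) are included. -/
def polarCSetStates (n : ℕ) : Set (Set (EuclideanSpace ℝ (Fin n))) :=
  {P | (0 : EuclideanSpace ℝ (Fin n)) ∈ P ∧ IsCSet (polarSet P)}

/-- The states in `S` whose trajectory under `F` converges to `Q` in the Hausdorff distance. -/
def domainOfAttraction {E : Type*} [PseudoEMetricSpace E] (F : Set E → Set E) (S : Set (Set E))
    (Q : Set E) : Set (Set E) :=
  {P | P ∈ S ∧ Tendsto (fun k : ℕ => Metric.hausdorffEDist (F^[k] P) Q) atTop (𝓝 0)}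

/-- `Q` is an asymptotically stable attractor of `F` on the state space `S`, with respect to the
Hausdorff distance: it is Lyapunov stable and attracts all states in a neighbourhood of it. -/
def IsAsymptoticallyStableAttractor {E : Type*} [PseudoEMetricSpace E] (F : Set E → Set E)
    (S : Set (Set E)) (Q : Set E) : Prop :=
  (∀ ε : ℝ≥0∞, 0 < ε → ∃ δ : ℝ≥0∞, 0 < δ ∧ ∀ P ∈ S, Metric.hausdorffEDist P Q < δ →
      ∀ k : ℕ, Metric.hausdorffEDist (F^[k] P) Q < ε) ∧
  (∃ δ : ℝ≥0∞, 0 < δ ∧ ∀ P ∈ S, Metric.hausdorffEDist P Q < δ → P ∈ domainOfAttraction F S Q)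

/-- The vector `(x, u) ∈ ℝⁿ⁺ᵐ`. -/
def jointVec {n m : ℕ} (x : EuclideanSpace ℝ (Fin n)) (u : EuclideanSpace ℝ (Fin m)) :
    EuclideanSpace ℝ (Fin n ⊕ Fin m) :=
  WithLp.toLp 2 (Sum.elim x u)

/-- The objective `u ↦ ℓ(x, u) + V(A x + B u)`, with the stage cost `ℓ` the Minkowski function
of `C`. -/
def bellmanObjective {n m : ℕ} (A : Matrix (Fin n) (Fin n) ℝ) (B : Matrix (Fin n) (Fin m) ℝ)
    (C : Set (EuclideanSpace ℝ (Fin n ⊕ Fin m))) (V : EuclideanSpace ℝ (Fin n) → ℝ)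
    (x : EuclideanSpace ℝ (Fin n)) (u : EuclideanSpace ℝ (Fin m)) : ℝ :=
  gauge C (jointVec x u) + V (Matrix.toEuclideanLin A x + Matrix.toEuclideanLin B u)

/-- `(V, U)` solves the fixed point Minkowski–Bellman equation: for all `x`, `V x` is the
(attained) minimum of the objective over `u`, and `U x` is the set of its minimizers. -/
def IsMinkowskiBellmanFixedPoint {n m : ℕ} (A : Matrix (Fin n) (Fin n) ℝ)
    (B : Matrix (Fin n) (Fin m) ℝ) (C : Set (EuclideanSpace ℝ (Fin n ⊕ Fin m)))
    (V : EuclideanSpace ℝ (Fin n) → ℝ)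
    (U : EuclideanSpace ℝ (Fin n) → Set (EuclideanSpace ℝ (Fin m))) : Prop :=
  ∀ x, IsLeast (Set.range (bellmanObjective A B C V x)) (V x) ∧
    U x = {u | ∀ v, bellmanObjective A B C V x u ≤ bellmanObjective A B C V x v}

end

/-!
The Minkowski function of the polar of a `C`-set is its support function, so polarity turns
Minkowski sums into sums and linear images into preimages. Hence the Minkowski function of
`(C* ⊕ (A B)ᵀ P*)*` is the Bellman objective with value function `V` the Minkowski function
of `P**`, and projecting to the state space minimises over `u`: the set dynamics is the Bellman
operator.

Value iteration from `V = 0`, that is, from the state `P = ℝⁿ`, is monotone. It is bounded by a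
multiple of the norm because stabilizability provides linear open-loop controls that halve the
state in finitely many steps. By compactness its limit is a fixed point.

At a fixed point `Q`, the stage cost dominates `V(Ax + Bu)` up to a constant `D`, so an error
`|V_P - V_Q| ≤ ε V_Q` is contracted by the factor `D / (1 + D)`. This contraction of the relative
error yields uniqueness, stability and global attraction, also from the unbounded states, which lie
at infinite Hausdorff distance.
-/

section Polar

variable {ι κ : Type*} [Fintype ι] [Fintype κ] {X Y : Set (EuclideanSpace ℝ ι)}

theorem polarSet_anti (h : X ⊆ Y) : polarSet Y ⊆ polarSet X :=
  fun _ hx y hy => hx y (h hy)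

theorem zero_mem_polarSet (X : Set (EuclideanSpace ℝ ι)) : 0 ∈ polarSet X :=
  fun y _ => (inner_zero_right y).trans_le zero_le_one

theorem isClosed_polarSet (X : Set (EuclideanSpace ℝ ι)) : IsClosed (polarSet X) := by
  have h : polarSet X = ⋂ y ∈ X, {x | inner ℝ y x ≤ 1} := by
    ext x
    simp only [polarSet, Set.mem_ofPred_eq, Set.mem_iInter]
  rw [h]
  exact isClosed_biInter fun y _ => isClosed_le (by fun_prop) continuous_const

theorem convex_polarSet (X : Set (EuclideanSpace ℝ ι)) : Convex ℝ (polarSet X) := by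
  intro x hx z hz a b ha hb hab y hy
  rw [inner_add_right, inner_smul_right, inner_smul_right]
  nlinarith [hx y hy, hz y hy]

theorem polarSet_polarSet_eq_self (hc : Convex ℝ X) (hX : IsClosed X) (h0 : 0 ∈ X) :
    polarSet (polarSet X) = X := by
  refine Set.Subset.antisymm (fun x hx => ?_) fun x hx y hy =>
    (real_inner_comm x y).trans_le (hy x hx)
  by_contra hxX
  obtain ⟨f, u, hfu, hux⟩ := geometric_hahn_banach_closed_point hc hX hxX
  have hu : 0 < u := by simpa only [map_zero] using hfu 0 h0
  obtain ⟨w, rfl⟩ := (InnerProductSpace.toDual ℝ (EuclideanSpace ℝ ι)).surjective f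
  simp only [InnerProductSpace.toDual_apply_apply] at hfu hux
  have hw : u⁻¹ • w ∈ polarSet X := fun y hy => by
    rw [inner_smul_right, real_inner_comm, inv_mul_le_iff₀ hu, mul_one]
    exact (hfu y hy).le
  have hwx := hx _ hw
  rw [real_inner_smul_left, inv_mul_le_iff₀ hu, mul_one] at hwx
  exact hux.not_ge hwx

theorem isBounded_polarSet (hX : X ∈ 𝓝 0) : Bornology.IsBounded (polarSet X) := by
  obtain ⟨r, hr, hrX⟩ := Metric.nhds_basis_closedBall.mem_iff.1 hX
  refine Metric.isBounded_closedBall (x := 0) (r := r⁻¹) |>.subset fun x hx => ?_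
  rw [mem_closedBall_zero_iff]
  rcases eq_or_ne x 0 with rfl | hx0
  · simpa only [norm_zero, inv_nonneg] using hr.le
  have hn : 0 < ‖x‖ := norm_pos_iff.2 hx0
  have hmem : (r * ‖x‖⁻¹) • x ∈ X := hrX <| mem_closedBall_zero_iff.2 <| by
    rw [norm_smul, Real.norm_of_nonneg (by positivity), inv_mul_cancel_right₀ hn.ne']
  have h := hx _ hmem
  rw [real_inner_smul_left, real_inner_self_eq_norm_sq, sq, mul_assoc,
    inv_mul_cancel_left₀ hn.ne'] at h
  exact (le_inv_mul_iff₀ hr).2 h |>.trans_eq (mul_one _)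

theorem isCSet_polarSet (hX : X ∈ 𝓝 0) : IsCSet (polarSet X) :=
  ⟨Metric.isCompact_of_isClosed_isBounded (isClosed_polarSet X) (isBounded_polarSet hX),
    convex_polarSet X, zero_mem_polarSet X⟩

theorem IsCSet.polarSet_polarSet (hX : IsCSet X) : polarSet (polarSet X) = X :=
  polarSet_polarSet_eq_self hX.2.1 hX.1.isClosed hX.2.2

theorem IsCSet.polarSet_mem_nhds (hX : IsCSet X) : polarSet X ∈ 𝓝 0 := by
  obtain ⟨R, hR, hXR⟩ := hX.1.isBounded.exists_pos_norm_le
  refine Metric.mem_nhds_iff.2 ⟨R⁻¹, inv_pos.2 hR, fun x hx y hy => ?_⟩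
  rw [mem_ball_zero_iff] at hx
  calc inner ℝ y x ≤ ‖y‖ * ‖x‖ := real_inner_le_norm y x
    _ ≤ R * R⁻¹ := by gcongr; exact hXR y hy
    _ = 1 := mul_inv_cancel₀ hR.ne'

theorem IsCSet.absorbent_polarSet (hX : IsCSet X) : Absorbent ℝ (polarSet X) :=
  absorbent_nhds_zero hX.polarSet_mem_nhds

theorem IsCSet.add (hX : IsCSet X) (hY : IsCSet Y) : IsCSet (X + Y) :=
  ⟨hX.1.add hY.1, hX.2.1.add hY.2.1, by simpa only [add_zero] using Set.add_mem_add hX.2.2 hY.2.2⟩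

protected theorem IsCSet.matImage [DecidableEq ι] (hX : IsCSet X) (M : Matrix κ ι ℝ) :
    IsCSet (matImage M X) :=
  ⟨hX.1.image (LinearMap.continuous_of_finiteDimensional _), hX.2.1.linear_image _,
    0, hX.2.2, map_zero _⟩

theorem IsProperCSet.mem_nhds (hX : IsProperCSet X) : X ∈ 𝓝 0 :=
  mem_interior_iff_mem_nhds.1 hX.2

theorem IsProperCSet.absorbent (hX : IsProperCSet X) : Absorbent ℝ X :=
  absorbent_nhds_zero hX.mem_nhds

theorem IsCSet.isProperCSet (hX : IsCSet X) (h : X ∈ 𝓝 0) : IsProperCSet X :=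
  ⟨hX, mem_interior_iff_mem_nhds.2 h⟩

protected theorem IsProperCSet.polarSet (hX : IsProperCSet X) : IsProperCSet (polarSet X) :=
  (isCSet_polarSet hX.mem_nhds).isProperCSet hX.1.polarSet_mem_nhds

theorem IsProperCSet.add_isCSet (hX : IsProperCSet X) (hY : IsCSet Y) : IsProperCSet (X + Y) :=
  (hX.1.add hY).isProperCSet (mem_of_superset hX.mem_nhds (Set.subset_add_left X hY.2.2))

protected theorem IsProperCSet.matImage [DecidableEq ι] (hX : IsProperCSet X) {M : Matrix κ ι ℝ}
    (hM : Function.Surjective (Matrix.toEuclideanLin M)) : IsProperCSet (matImage M X) := by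
  refine (hX.1.matImage M).isProperCSet ?_
  have h := (LinearMap.isOpenMap_of_finiteDimensional _ hM).image_mem_nhds hX.mem_nhds
  rwa [map_zero] at h

end Polar

section Gauge

variable {ι κ : Type*} [Fintype ι] [Fintype κ] {X Y : Set (EuclideanSpace ℝ ι)}

theorem IsProperCSet.gauge_le_one_iff (hX : IsProperCSet X) {x : EuclideanSpace ℝ ι} :
    gauge X x ≤ 1 ↔ x ∈ X := by
  rw [gauge_le_one_iff_mem_closure hX.1.2.1 hX.mem_nhds, hX.1.1.isClosed.closure_eq]

theorem IsProperCSet.gauge_le_iff (hX : IsProperCSet X) {t : ℝ} (ht : 0 < t)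
    {x : EuclideanSpace ℝ ι} : gauge X x ≤ t ↔ t⁻¹ • x ∈ X := by
  rw [← hX.gauge_le_one_iff, gauge_smul_of_nonneg (inv_nonneg.2 ht.le), smul_eq_mul,
    inv_mul_le_iff₀ ht, mul_one]

theorem IsProperCSet.gauge_pos_iff (hX : IsProperCSet X) {x : EuclideanSpace ℝ ι} :
    0 < gauge X x ↔ x ≠ 0 :=
  gauge_pos hX.absorbent (NormedSpace.isVonNBounded_of_isBounded ℝ hX.1.1.isBounded)

theorem IsProperCSet.gauge_injective (hX : IsProperCSet X) (hY : IsProperCSet Y)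
    (h : gauge X = gauge Y) : X = Y := by
  ext x
  rw [← hX.gauge_le_one_iff, h, hY.gauge_le_one_iff]

theorem gauge_iInter_le {J : Sort*} [Nonempty J] {I : J → Set (EuclideanSpace ℝ ι)}
    (hI : ∀ j, IsProperCSet (I j)) {t : ℝ} {x : EuclideanSpace ℝ ι}
    (h : ∀ j, gauge (I j) x ≤ t) : gauge (⋂ j, I j) x ≤ t := by
  have ht : 0 ≤ t := (gauge_nonneg x).trans (h (Classical.arbitrary J))
  refine le_of_forall_gt_imp_ge_of_dense fun s hts => ?_
  have hs : 0 < s := ht.trans_lt hts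
  refine gauge_le_of_mem hs.le ((Set.mem_smul_set_iff_inv_smul_mem₀ hs.ne' _ _).2 ?_)
  exact Set.mem_iInter.2 fun j => ((hI j).gauge_le_iff hs).1 ((h j).trans hts.le)

theorem IsProperCSet.exists_norm_le (hX : IsProperCSet X) :
    ∃ R : ℝ, 0 < R ∧ ∀ x, ‖x‖ ≤ R * gauge X x := by
  obtain ⟨R, hR, hXR⟩ := hX.1.1.isBounded.subset_closedBall_lt 0 0
  refine ⟨R, hR, fun x => ?_⟩
  rw [← div_le_iff₀' hR]
  exact le_gauge_of_subset_closedBall hX.absorbent hR.le hXR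

theorem exists_gauge_map_le_mul_norm {V W : Type*} [NormedAddCommGroup V] [NormedSpace ℝ V]
    [FiniteDimensional ℝ V] [SeminormedAddCommGroup W] [NormedSpace ℝ W] {S : Set W}
    (hS : S ∈ 𝓝 0) (f : V →ₗ[ℝ] W) :
    ∃ K : ℝ, 0 < K ∧ ∀ x, gauge S (f x) ≤ K * ‖x‖ := by
  obtain ⟨r, hr, hrS⟩ := Metric.mem_nhds_iff.1 hS
  obtain ⟨k, hk, hf⟩ := f.toContinuousLinearMap.bound
  refine ⟨r⁻¹ * k, by positivity, fun x => ?_⟩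
  rw [mul_assoc, le_inv_mul_iff₀ hr]
  exact (mul_gauge_le_norm hrS).trans (hf x)

theorem IsProperCSet.exists_gauge_map_le (hX : IsProperCSet X) {W : Type*}
    [SeminormedAddCommGroup W] [NormedSpace ℝ W] {S : Set W} (hS : S ∈ 𝓝 0)
    (f : EuclideanSpace ℝ ι →ₗ[ℝ] W) : ∃ D : ℝ, 0 < D ∧ ∀ x, gauge S (f x) ≤ D * gauge X x := by
  obtain ⟨R, hR, hRX⟩ := hX.exists_norm_le
  obtain ⟨K, hK, hKS⟩ := exists_gauge_map_le_mul_norm hS f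
  refine ⟨K * R, by positivity, fun x => (hKS x).trans ?_⟩
  rw [mul_assoc]
  gcongr
  exact hRX x

theorem IsProperCSet.isLeast_gauge_matImage [DecidableEq ι] (hX : IsProperCSet X)
    {M : Matrix κ ι ℝ} (hM : Function.Surjective (Matrix.toEuclideanLin M))
    (y : EuclideanSpace ℝ κ) :
    IsLeast (gauge X '' {x | Matrix.toEuclideanLin M x = y}) (gauge (matImage M X) y) := by
  have hMX := hX.matImage hM
  have lower : ∀ x, gauge (matImage M X) (Matrix.toEuclideanLin M x) ≤ gauge X x :=
    fun x => le_of_forall_gt_imp_ge_of_dense fun a ha => by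
      obtain ⟨b, hb, hba, z, hz, rfl⟩ := exists_lt_of_gauge_lt hX.absorbent ha
      rw [map_smul]
      have hbz := Set.smul_mem_smul_set (a := b) (Set.mem_image_of_mem (Matrix.toEuclideanLin M) hz)
      exact (gauge_le_of_mem hb.le hbz).trans hba.le
  refine ⟨?_, by rintro _ ⟨x, rfl, rfl⟩; exact lower x⟩
  rcases eq_or_ne y 0 with rfl | hy
  · exact ⟨0, map_zero _, by rw [gauge_zero, gauge_zero]⟩
  set t := gauge (matImage M X) y with ht
  have ht0 : 0 < t := hMX.gauge_pos_iff.2 hy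
  obtain ⟨x, hx, hxy⟩ := (hMX.gauge_le_iff ht0).1 ht.ge
  have hy' : Matrix.toEuclideanLin M (t • x) = y := by
    rw [map_smul]
    exact (eq_inv_smul_iff₀ ht0.ne').1 hxy
  refine ⟨t • x, hy', le_antisymm ?_ (by simpa only [hy'] using lower (t • x))⟩
  rw [gauge_smul_of_nonneg ht0.le, smul_eq_mul]
  exact mul_le_of_le_one_right ht0.le (gauge_le_one_of_mem hx)

end Gauge

section SupportFunction

variable {ι κ : Type*} [Fintype ι] [Fintype κ] {X Y : Set (EuclideanSpace ℝ ι)}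

theorem IsCSet.inner_le_gauge_polarSet (hX : IsCSet X) {w x : EuclideanSpace ℝ ι} (hw : w ∈ X) :
    inner ℝ w x ≤ gauge (polarSet X) x :=
  le_of_forall_gt_imp_ge_of_dense fun a ha => by
    obtain ⟨b, hb, hba, z, hz, rfl⟩ := exists_lt_of_gauge_lt hX.absorbent_polarSet ha
    rw [inner_smul_right]
    exact (mul_le_of_le_one_right hb.le (hz w hw)).trans hba.le

theorem IsCSet.gauge_polarSet_le_iff (hX : IsCSet X) {t : ℝ} {x : EuclideanSpace ℝ ι} :
    gauge (polarSet X) x ≤ t ↔ ∀ w ∈ X, inner ℝ w x ≤ t := by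
  refine ⟨fun h w hw => (hX.inner_le_gauge_polarSet hw).trans h, fun h => ?_⟩
  have ht : 0 ≤ t := by simpa only [inner_zero_left] using h 0 hX.2.2
  refine le_of_forall_gt_imp_ge_of_dense fun s hts => ?_
  have hs : 0 < s := ht.trans_lt hts
  refine gauge_le_of_mem hs.le ((Set.mem_smul_set_iff_inv_smul_mem₀ hs.ne' _ _).2 fun w hw => ?_)
  rw [inner_smul_right, inv_mul_le_iff₀ hs, mul_one]
  exact (h w hw).trans hts.le

theorem IsCSet.gauge_polarSet_add (hX : IsCSet X) (hY : IsCSet Y) (x : EuclideanSpace ℝ ι) :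
    gauge (polarSet (X + Y)) x = gauge (polarSet X) x + gauge (polarSet Y) x := by
  refine le_antisymm ((hX.add hY).gauge_polarSet_le_iff.2 ?_) ?_
  · rintro _ ⟨v, hv, w, hw, rfl⟩
    rw [inner_add_left]
    exact add_le_add (hX.inner_le_gauge_polarSet hv) (hY.inner_le_gauge_polarSet hw)
  · rw [← le_sub_iff_add_le, hX.gauge_polarSet_le_iff]
    intro v hv
    rw [le_sub_comm, hY.gauge_polarSet_le_iff]
    intro w hw
    rw [le_sub_iff_add_le', ← inner_add_left]
    exact (hX.add hY).inner_le_gauge_polarSet (Set.add_mem_add hv hw)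

theorem inner_toEuclideanLin_transpose [DecidableEq ι] [DecidableEq κ] (M : Matrix κ ι ℝ)
    (w : EuclideanSpace ℝ κ) (x : EuclideanSpace ℝ ι) :
    inner ℝ (Matrix.toEuclideanLin M.transpose w) x = inner ℝ w (Matrix.toEuclideanLin M x) := by
  rw [← Matrix.conjTranspose_eq_transpose_of_trivial,
    Matrix.toEuclideanLin_conjTranspose_eq_adjoint, LinearMap.adjoint_inner_left]

theorem IsCSet.gauge_polarSet_matImage_transpose [DecidableEq ι] [DecidableEq κ] (hX : IsCSet X)
    (M : Matrix ι κ ℝ) (x : EuclideanSpace ℝ κ) :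
    gauge (polarSet (matImage M.transpose X)) x =
      gauge (polarSet X) (Matrix.toEuclideanLin M x) :=
  eq_of_forall_ge_iff fun t => by
    rw [(hX.matImage M.transpose).gauge_polarSet_le_iff, hX.gauge_polarSet_le_iff]
    simp only [matImage, Set.forall_mem_image, inner_toEuclideanLin_transpose]

theorem IsCSet.mul_gauge_polarSet_le (hX : IsCSet X) (hY : IsCSet Y) {c : ℝ} (hc : 0 < c)
    (h : ∀ w ∈ X, c • w ∈ Y) (x : EuclideanSpace ℝ ι) :
    c * gauge (polarSet X) x ≤ gauge (polarSet Y) x := by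
  rw [← le_inv_mul_iff₀ hc, hX.gauge_polarSet_le_iff]
  intro w hw
  rw [le_inv_mul_iff₀ hc, ← real_inner_smul_left]
  exact hY.inner_le_gauge_polarSet (h w hw)

theorem IsProperCSet.inner_le_gauge_mul_gauge_polarSet (hX : IsProperCSet X)
    (x w : EuclideanSpace ℝ ι) : inner ℝ x w ≤ gauge X x * gauge (polarSet X) w := by
  rcases eq_or_ne x 0 with rfl | hx
  · rw [inner_zero_left, gauge_zero, zero_mul]
  · have hx0 := hX.gauge_pos_iff.2 hx
    rw [← inv_mul_le_iff₀ hx0, ← real_inner_smul_left]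
    exact hX.1.inner_le_gauge_polarSet ((hX.gauge_le_iff hx0).1 le_rfl)

/-- The Minkowski function of the bipolar of `P`, that is, the support function of `P*`. It is the
value function attached to a state `P` of the set dynamics, which need be neither closed nor
convex nor bounded. -/
noncomputable def bipolarGauge (P : Set (EuclideanSpace ℝ ι)) : EuclideanSpace ℝ ι → ℝ :=
  gauge (polarSet (polarSet P))

theorem IsProperCSet.bipolarGauge_eq (hX : IsProperCSet X) : bipolarGauge X = gauge X := by
  rw [bipolarGauge, hX.1.polarSet_polarSet]

theorem bipolarGauge_anti (hX : IsCSet (polarSet X)) (h : X ⊆ Y) :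
    bipolarGauge Y ≤ bipolarGauge X :=
  gauge_mono hX.absorbent_polarSet (polarSet_anti (polarSet_anti h))

theorem bipolarGauge_univ : bipolarGauge (Set.univ : Set (EuclideanSpace ℝ ι)) = 0 := by
  rw [bipolarGauge, polarSet_polarSet_eq_self convex_univ isClosed_univ (Set.mem_univ _)]
  funext x
  refine le_antisymm (le_of_forall_gt_imp_ge_of_dense fun a ha => ?_) (gauge_nonneg x)
  refine gauge_le_of_mem ha.le ?_
  rw [Set.smul_set_univ₀ (show a ≠ 0 from ha.ne')]
  exact Set.mem_univ x

end SupportFunction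

section StrictStability

theorem tendsto_pow_zero_of_forall_spectrum_norm_lt_one {R : Type*} [NormedRing R]
    [NormedAlgebra ℂ R] [CompleteSpace R] {a : R} (ha : ∀ z ∈ spectrum ℂ a, ‖z‖ < 1) :
    Tendsto (fun k : ℕ => a ^ k) atTop (𝓝 0) := by
  rcases subsingleton_or_nontrivial R with h | h
  · exact tendsto_const_nhds.congr fun k => Subsingleton.elim _ _
  have hρ : spectralRadius ℂ a < (1 : NNReal) :=
    spectrum.spectralRadius_lt_of_forall_lt a fun z hz => by exact_mod_cast ha z hz
  obtain ⟨q, hρq, hq1⟩ := ENNReal.lt_iff_exists_nnreal_btwn.1 hρ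
  have hq1 : (q : ℝ) < 1 := by exact_mod_cast hq1
  have gelfand :=
    (spectrum.pow_nnnorm_pow_one_div_tendsto_nhds_spectralRadius a).eventually_lt_const hρq
  refine squeeze_zero_norm' ?_ (tendsto_pow_atTop_nhds_zero_of_lt_one q.2 hq1)
  filter_upwards [gelfand, eventually_gt_atTop 0] with k hk hk0
  have hk0 : (0 : ℝ) < k := by exact_mod_cast hk0
  have hle : (‖a ^ k‖₊ : ℝ≥0∞) ≤ (q : ℝ≥0∞) ^ k := by
    rw [← ENNReal.rpow_natCast, ← ENNReal.rpow_inv_le_iff hk0, ← one_div]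
    exact hk.le
  exact_mod_cast hle

section

attribute [local instance] Matrix.linftyOpNormedRing Matrix.linftyOpNormedAlgebra

theorem tendsto_matrix_pow_zero_of_charpoly {ι : Type*} [Fintype ι] [DecidableEq ι]
    {M : Matrix ι ι ℝ} (hM : ∀ z : ℂ, Polynomial.aeval z M.charpoly = 0 → ‖z‖ < 1) :
    Tendsto (fun k : ℕ => M ^ k) atTop (𝓝 0) := by
  have complex : Tendsto (fun k : ℕ => (M.map (algebraMap ℝ ℂ)) ^ k) atTop (𝓝 0) :=
    tendsto_pow_zero_of_forall_spectrum_norm_lt_one fun z hz => hM z <| by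
      rwa [Matrix.mem_spectrum_iff_isRoot_charpoly, Matrix.charpoly_map, Polynomial.IsRoot,
        Polynomial.eval_map_algebraMap] at hz
  have real : Continuous fun N : Matrix ι ι ℂ => N.map Complex.re :=
    continuous_id.matrix_map Complex.continuous_re
  have h := (real.tendsto 0).comp complex
  rw [Matrix.map_zero _ Complex.zero_re] at h
  refine h.congr fun k => ?_
  have hpow : M.map (algebraMap ℝ ℂ) ^ k = (M ^ k).map (algebraMap ℝ ℂ) :=
    (map_pow (algebraMap ℝ ℂ).mapMatrix M k).symm
  ext i j
  rw [Function.comp_apply, hpow]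
  rfl

end

theorem tendsto_map_pow_zero_of_charpoly {W F : Type*} [AddCommGroup W] [Module ℝ W]
    [FiniteDimensional ℝ W] [AddCommGroup F] [Module ℝ F] [TopologicalSpace F]
    [IsTopologicalAddGroup F] [ContinuousSMul ℝ F] {g : Module.End ℝ W}
    (hg : ∀ z : ℂ, Polynomial.aeval z g.charpoly = 0 → ‖z‖ < 1) (Φ : Module.End ℝ W →ₗ[ℝ] F) :
    Tendsto (fun k : ℕ => Φ (g ^ k)) atTop (𝓝 0) := by
  let b := Module.finBasis ℝ W
  have matrix : Tendsto (fun k : ℕ => LinearMap.toMatrix b b g ^ k) atTop (𝓝 0) :=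
    tendsto_matrix_pow_zero_of_charpoly fun z hz => hg z (by
      rwa [LinearMap.charpoly_toMatrix] at hz)
  have hΦ := (Φ ∘ₗ (Matrix.toLin b b).toLinearMap).continuous_of_finiteDimensional
  have h := (hΦ.tendsto 0).comp matrix
  rw [map_zero] at h
  refine h.congr fun k => ?_
  simp only [Function.comp_apply, LinearMap.comp_apply, LinearEquiv.coe_coe,
    LinearMap.toMatrix_pow, Matrix.toLin_toMatrix]

theorem eventually_exists_norm_le_of_charpoly_mapQ {V : Type*} [NormedAddCommGroup V]
    [NormedSpace ℝ V] [FiniteDimensional ℝ V] {f : Module.End ℝ V} {Q : Submodule ℝ V}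
    (hQ : Q ≤ Q.comap f)
    (h : ∀ z : ℂ, Polynomial.aeval z (Q.mapQ Q f hQ).charpoly = 0 → ‖z‖ < 1)
    {ε : ℝ} (hε : 0 < ε) :
    ∀ᶠ N : ℕ in atTop, ∃ L : Module.End ℝ V,
      LinearMap.range (L - f ^ N) ≤ Q ∧ ∀ x, ‖L x‖ ≤ ε * ‖x‖ := by
  obtain ⟨s, hs⟩ := Q.mkQ.exists_rightInverse_of_surjective Q.range_mkQ
  let Φ : Module.End ℝ (V ⧸ Q) →ₗ[ℝ] (V →L[ℝ] V) :=
    LinearMap.toContinuousLinearMap.toLinearMap ∘ₗ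
      LinearMap.lcomp ℝ V Q.mkQ ∘ₗ LinearMap.llcomp ℝ (V ⧸ Q) (V ⧸ Q) V s
  have hΦ := tendsto_zero_iff_norm_tendsto_zero.1 (tendsto_map_pow_zero_of_charpoly h Φ)
  filter_upwards [hΦ.eventually_lt_const hε] with N hN
  refine ⟨s ∘ₗ (Q.mapQ Q f hQ ^ N) ∘ₗ Q.mkQ, ?_, (Φ (Q.mapQ Q f hQ ^ N)).le_of_opNorm_le hN.le⟩
  conv_rhs => rw [← Q.ker_mkQ]
  rw [LinearMap.range_le_ker_iff, LinearMap.comp_sub, ← LinearMap.comp_assoc, hs,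
    LinearMap.id_comp, ← Submodule.mapQ_pow, Submodule.mapQ_mkQ, sub_self]

end StrictStability

section Reachability

variable {n m : ℕ} {A : Matrix (Fin n) (Fin n) ℝ} {B : Matrix (Fin n) (Fin m) ℝ}

/-- The subspace of the states reachable from the origin in `N` steps. -/
noncomputable def reachableSubspace (A : Matrix (Fin n) (Fin n) ℝ) (B : Matrix (Fin n) (Fin m) ℝ) :
    ℕ → Submodule ℝ (EuclideanSpace ℝ (Fin n))
  | 0 => ⊥
  | N + 1 => LinearMap.range (Matrix.toEuclideanLin B) ⊔
      (reachableSubspace A B N).map (Matrix.toEuclideanLin A)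

theorem reachableSubspace_mono : Monotone (reachableSubspace A B) := by
  refine monotone_nat_of_le_succ fun N => ?_
  induction N with
  | zero => exact bot_le
  | succ N ih => exact sup_le_sup le_rfl (Submodule.map_mono ih)

theorem range_pow_mul_le_reachableSubspace (k : ℕ) :
    LinearMap.range (Matrix.toEuclideanLin (A ^ k * B)) ≤ reachableSubspace A B (k + 1) := by
  induction k with
  | zero =>
    rw [pow_zero, Matrix.one_mul]
    exact le_sup_left
  | succ k ih =>
    rw [pow_succ', Matrix.mul_assoc, Matrix.toLpLin_mul_same, LinearMap.range_comp]
    exact (Submodule.map_mono ih).trans le_sup_right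

theorem eventually_controllableSubspace_le_reachableSubspace :
    ∀ᶠ N in atTop, controllableSubspace A B ≤ reachableSubspace A B N := by
  let R : ℕ →o Submodule ℝ (EuclideanSpace ℝ (Fin n)) :=
    ⟨reachableSubspace A B, reachableSubspace_mono⟩
  filter_upwards [eventually_ge_atTop (monotonicSequenceLimitIndex R)] with N hN
  refine iSup_le fun k => (range_pow_mul_le_reachableSubspace k).trans ?_
  exact (le_iSup R (k + 1)).trans ((WellFoundedGT.iSup_eq_monotonicSequenceLimit R).trans_le
    (R.mono hN))

theorem exists_comp_eq_of_range_le {K V W E : Type*} [Field K] [AddCommGroup V]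
    [Module K V] [AddCommGroup W] [Module K W] [AddCommGroup E] [Module K E]
    {f : V →ₗ[K] W} {g : E →ₗ[K] W} (h : LinearMap.range g ≤ LinearMap.range f) :
    ∃ k : E →ₗ[K] V, f ∘ₗ k = g := by
  obtain ⟨k, hk⟩ := Module.projective_lifting_property f.rangeRestrict
    (g.codRestrict (LinearMap.range f) fun x => h ⟨x, rfl⟩) f.surjective_rangeRestrict
  exact ⟨k, LinearMap.ext fun x => congrArg Subtype.val (LinearMap.congr_fun hk x)⟩

theorem exists_eq_comp_add_comp_of_range_le_reachableSubspace {E : Type*} [AddCommGroup E]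
    [Module ℝ E] {N : ℕ} {R : E →ₗ[ℝ] EuclideanSpace ℝ (Fin n)}
    (hR : LinearMap.range R ≤ reachableSubspace A B (N + 1)) :
    ∃ (K : E →ₗ[ℝ] EuclideanSpace ℝ (Fin m)) (S : E →ₗ[ℝ] EuclideanSpace ℝ (Fin n)),
      LinearMap.range S ≤ reachableSubspace A B N ∧
        R = Matrix.toEuclideanLin A ∘ₗ S + Matrix.toEuclideanLin B ∘ₗ K := by
  let ι := (reachableSubspace A B N).subtype
  have hrange : LinearMap.range ((Matrix.toEuclideanLin B).coprod (Matrix.toEuclideanLin A ∘ₗ ι)) =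
      reachableSubspace A B (N + 1) := by
    rw [LinearMap.range_coprod, LinearMap.range_comp, Submodule.range_subtype, reachableSubspace]
  obtain ⟨k, rfl⟩ := exists_comp_eq_of_range_le (hR.trans_eq hrange.symm)
  refine ⟨LinearMap.fst ℝ _ _ ∘ₗ k, ι ∘ₗ LinearMap.snd ℝ _ _ ∘ₗ k, ?_, ?_⟩
  · rintro _ ⟨x, rfl⟩
    exact Submodule.coe_mem _
  · exact LinearMap.ext fun x => add_comm _ _

theorem IsStrictlyStabilizable.exists_range_le_reachableSubspace (h : IsStrictlyStabilizable A B)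
    {ε : ℝ} (hε : 0 < ε) :
    ∃ (N : ℕ) (R : Module.End ℝ (EuclideanSpace ℝ (Fin n))),
      0 < N ∧ LinearMap.range R ≤ reachableSubspace A B N ∧
        ∀ x, ‖(Matrix.toEuclideanLin A ^ N + R) x‖ ≤ ε * ‖x‖ := by
  obtain ⟨N, hN0, hN, L, hL, hLε⟩ := ((eventually_gt_atTop 0).and
    (eventually_controllableSubspace_le_reachableSubspace.and
      (eventually_exists_norm_le_of_charpoly_mapQ (controllableSubspace_invariant A B) h
        hε))).exists
  exact ⟨N, _, hN0, hL.trans hN, by simpa only [add_sub_cancel] using hLε⟩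

end Reachability

section BellmanOperator

variable {n m : ℕ} {A : Matrix (Fin n) (Fin n) ℝ} {B : Matrix (Fin n) (Fin m) ℝ}
  {C : Set (EuclideanSpace ℝ (Fin n ⊕ Fin m))} {P Q : Set (EuclideanSpace ℝ (Fin n))}

theorem exists_jointVec_eq (p : EuclideanSpace ℝ (Fin n ⊕ Fin m)) : ∃ x u, jointVec x u = p :=
  ⟨(EuclideanSpace.sumEquivProd p).1, (EuclideanSpace.sumEquivProd p).2,
    EuclideanSpace.sumEquivProd.symm_apply_apply p⟩

theorem toEuclideanLin_fromCols_jointVec (x : EuclideanSpace ℝ (Fin n))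
    (u : EuclideanSpace ℝ (Fin m)) :
    Matrix.toEuclideanLin (Matrix.fromCols A B) (jointVec x u) =
      Matrix.toEuclideanLin A x + Matrix.toEuclideanLin B u := by
  simp only [jointVec, Matrix.toLpLin_apply, Matrix.fromCols_mulVec_sumElim, WithLp.toLp_add]

theorem toEuclideanLin_fromCols_one_zero_jointVec (x : EuclideanSpace ℝ (Fin n))
    (u : EuclideanSpace ℝ (Fin m)) :
    Matrix.toEuclideanLin (Matrix.fromCols (1 : Matrix (Fin n) (Fin n) ℝ) 0) (jointVec x u) =
      x := by
  rw [toEuclideanLin_fromCols_jointVec, map_zero, LinearMap.zero_apply, add_zero,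
    Matrix.toLpLin_one, LinearMap.id_apply]

theorem surjective_toEuclideanLin_fromCols_one_zero :
    Function.Surjective (Matrix.toEuclideanLin
      (Matrix.fromCols (1 : Matrix (Fin n) (Fin n) ℝ) (0 : Matrix (Fin n) (Fin m) ℝ))) :=
  fun x => ⟨_, toEuclideanLin_fromCols_one_zero_jointVec x 0⟩

/-- The set `(C* ⊕ (A B)ᵀ P*)*` in `ℝⁿ⁺ᵐ`, of which `setDynamics` takes the projection. Its
Minkowski function is the Bellman objective as a function of `(x, u)`. -/
def jointPolar (A : Matrix (Fin n) (Fin n) ℝ) (B : Matrix (Fin n) (Fin m) ℝ)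
    (C : Set (EuclideanSpace ℝ (Fin n ⊕ Fin m))) (P : Set (EuclideanSpace ℝ (Fin n))) :
    Set (EuclideanSpace ℝ (Fin n ⊕ Fin m)) :=
  polarSet (polarSet C + matImage (Matrix.fromCols A B).transpose (polarSet P))

theorem setDynamics_eq_matImage_jointPolar :
    setDynamics A B C P = matImage (Matrix.fromCols 1 0) (jointPolar A B C P) :=
  rfl

theorem isProperCSet_jointPolar (hC : IsProperCSet C) (hP : IsCSet (polarSet P)) :
    IsProperCSet (jointPolar A B C P) :=
  (hC.polarSet.add_isCSet (hP.matImage _)).polarSet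

theorem isProperCSet_setDynamics (hC : IsProperCSet C) (hP : IsCSet (polarSet P)) :
    IsProperCSet (setDynamics A B C P) :=
  (isProperCSet_jointPolar hC hP).matImage surjective_toEuclideanLin_fromCols_one_zero

theorem jointPolar_mono (h : P ⊆ Q) : jointPolar A B C P ⊆ jointPolar A B C Q :=
  polarSet_anti (Set.add_subset_add_left (Set.image_mono (polarSet_anti h)))

theorem setDynamics_mono : Monotone (setDynamics A B C) :=
  fun _ _ h => Set.image_mono (jointPolar_mono h)

theorem gauge_jointPolar (hC : IsProperCSet C) (hP : IsCSet (polarSet P))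
    (p : EuclideanSpace ℝ (Fin n ⊕ Fin m)) :
    gauge (jointPolar A B C P) p =
      gauge C p + bipolarGauge P (Matrix.toEuclideanLin (Matrix.fromCols A B) p) := by
  rw [jointPolar, hC.polarSet.1.gauge_polarSet_add (hP.matImage _), hC.1.polarSet_polarSet,
    hP.gauge_polarSet_matImage_transpose, bipolarGauge]

theorem gauge_jointPolar_jointVec (hC : IsProperCSet C) (hP : IsCSet (polarSet P))
    (x : EuclideanSpace ℝ (Fin n)) (u : EuclideanSpace ℝ (Fin m)) :
    gauge (jointPolar A B C P) (jointVec x u) =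
      bellmanObjective A B C (bipolarGauge P) x u := by
  rw [gauge_jointPolar hC hP, toEuclideanLin_fromCols_jointVec, bellmanObjective]

theorem isLeast_gauge_setDynamics (hC : IsProperCSet C) (hP : IsCSet (polarSet P))
    (x : EuclideanSpace ℝ (Fin n)) :
    IsLeast (Set.range (bellmanObjective A B C (bipolarGauge P) x))
      (gauge (setDynamics A B C P) x) := by
  rw [setDynamics_eq_matImage_jointPolar]
  convert (isProperCSet_jointPolar hC hP).isLeast_gauge_matImage
    surjective_toEuclideanLin_fromCols_one_zero x using 1
  ext t
  constructor
  · rintro ⟨u, rfl⟩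
    exact ⟨jointVec x u, toEuclideanLin_fromCols_one_zero_jointVec x u,
      gauge_jointPolar_jointVec hC hP x u⟩
  · rintro ⟨p, hp, rfl⟩
    obtain ⟨y, u, rfl⟩ := exists_jointVec_eq p
    rw [Set.mem_ofPred_eq, toEuclideanLin_fromCols_one_zero_jointVec] at hp
    exact ⟨u, hp ▸ (gauge_jointPolar_jointVec hC hP y u).symm⟩

theorem IsProperCSet.mem_polarCSetStates (hP : IsProperCSet P) : P ∈ polarCSetStates n :=
  ⟨hP.1.2.2, hP.polarSet.1⟩

theorem isProperCSet_iterate_succ_setDynamics (hC : IsProperCSet C) (hP : IsCSet (polarSet P))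
    (k : ℕ) : IsProperCSet ((setDynamics A B C)^[k + 1] P) := by
  induction k generalizing P with
  | zero => exact isProperCSet_setDynamics hC hP
  | succ _ ih => exact ih (isProperCSet_setDynamics hC hP).polarSet.1

theorem isCSet_polarSet_iterate_setDynamics (hC : IsProperCSet C) (hP : IsCSet (polarSet P))
    (k : ℕ) : IsCSet (polarSet ((setDynamics A B C)^[k] P)) := by
  cases k with
  | zero => exact hP
  | succ k => exact (isProperCSet_iterate_succ_setDynamics hC hP k).polarSet.1

end BellmanOperator

section ValueIteration

variable {n m : ℕ} {A : Matrix (Fin n) (Fin n) ℝ} {B : Matrix (Fin n) (Fin m) ℝ}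
  {C : Set (EuclideanSpace ℝ (Fin n ⊕ Fin m))}

theorem exists_gauge_jointVec_le {E : Type*} [NormedAddCommGroup E] [NormedSpace ℝ E]
    [FiniteDimensional ℝ E] (hC : C ∈ 𝓝 0) (L : E →ₗ[ℝ] EuclideanSpace ℝ (Fin n))
    (K : E →ₗ[ℝ] EuclideanSpace ℝ (Fin m)) :
    ∃ M : ℝ, 0 < M ∧ ∀ x, gauge C (jointVec (L x) (K x)) ≤ M * ‖x‖ :=
  exists_gauge_map_le_mul_norm hC
    (EuclideanSpace.sumEquivProd.symm.toLinearEquiv.toLinearMap ∘ₗ L.prod K)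

theorem exists_bipolarGauge_iterate_setDynamics_le (hC : IsProperCSet C) {N : ℕ}
    {R : Module.End ℝ (EuclideanSpace ℝ (Fin n))}
    (hR : LinearMap.range R ≤ reachableSubspace A B N) :
    ∃ M : ℝ, 0 ≤ M ∧ ∀ P, IsCSet (polarSet P) → ∀ x,
      bipolarGauge ((setDynamics A B C)^[N] P) x ≤
        M * ‖x‖ + bipolarGauge P ((Matrix.toEuclideanLin A ^ N + R) x) := by
  induction N generalizing R with
  | zero =>
    obtain rfl : R = 0 := LinearMap.range_eq_bot.1 (le_bot_iff.1 hR)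
    refine ⟨0, le_rfl, fun P _ x => ?_⟩
    rw [Function.iterate_zero_apply, pow_zero, add_zero, Module.End.one_apply, zero_mul, zero_add]
  | succ N ih =>
    obtain ⟨K, S, hS, rfl⟩ := exists_eq_comp_add_comp_of_range_le_reachableSubspace hR
    obtain ⟨M₁, hM₁, steer⟩ := ih hS
    obtain ⟨M₂, hM₂, stage⟩ :=
      exists_gauge_jointVec_le hC.mem_nhds (Matrix.toEuclideanLin A ^ N + S) K
    refine ⟨M₁ + M₂, by positivity, fun P hP x => ?_⟩
    set y := (Matrix.toEuclideanLin A ^ N + S) x with hy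
    have hFP := isProperCSet_setDynamics (A := A) (B := B) hC hP
    have step : bipolarGauge (setDynamics A B C P) y ≤
        gauge C (jointVec y (K x)) +
          bipolarGauge P (Matrix.toEuclideanLin A y + Matrix.toEuclideanLin B (K x)) :=
      hFP.bipolarGauge_eq ▸ (isLeast_gauge_setDynamics hC hP y).2 ⟨K x, rfl⟩
    have final : Matrix.toEuclideanLin A y + Matrix.toEuclideanLin B (K x) =
        (Matrix.toEuclideanLin A ^ (N + 1) +
          (Matrix.toEuclideanLin A ∘ₗ S + Matrix.toEuclideanLin B ∘ₗ K)) x := by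
      simp only [hy, pow_succ', LinearMap.add_apply, Module.End.mul_apply, LinearMap.comp_apply,
        map_add, add_assoc]
    rw [Function.iterate_succ_apply, ← final]
    linarith [steer _ hFP.polarSet.1 x, stage x]

theorem antitone_iterate_setDynamics_univ :
    Antitone fun k => (setDynamics A B C)^[k] Set.univ :=
  setDynamics_mono.antitone_iterate_of_map_le (Set.subset_univ _)

theorem isCSet_polarSet_univ {ι : Type*} [Fintype ι] :
    IsCSet (polarSet (Set.univ : Set (EuclideanSpace ℝ ι))) :=
  isCSet_polarSet univ_mem

theorem IsStrictlyStabilizable.exists_bipolarGauge_iterate_univ_le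
    (hAB : IsStrictlyStabilizable A B) (hC : IsProperCSet C) :
    ∃ M : ℝ, ∀ k x, bipolarGauge ((setDynamics A B C)^[k] Set.univ) x ≤ M * ‖x‖ := by
  obtain ⟨N, R, hN, hR, halved⟩ := hAB.exists_range_le_reachableSubspace (ε := 1 / 2) (by norm_num)
  obtain ⟨M, hM, steer⟩ := exists_bipolarGauge_iterate_setDynamics_le hC hR
  have isCSet_iterate : ∀ k, IsCSet (polarSet ((setDynamics A B C)^[k] Set.univ)) :=
    isCSet_polarSet_iterate_setDynamics hC isCSet_polarSet_univ
  have multiples : ∀ j x,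
      bipolarGauge ((setDynamics A B C)^[N * j] Set.univ) x ≤ 2 * M * ‖x‖ := by
    intro j
    induction j with
    | zero =>
      intro x
      rw [mul_zero, Function.iterate_zero_apply, bipolarGauge_univ, Pi.zero_apply]
      positivity
    | succ j ih =>
      intro x
      set y := (Matrix.toEuclideanLin A ^ N + R) x
      calc bipolarGauge ((setDynamics A B C)^[N * (j + 1)] Set.univ) x
          ≤ M * ‖x‖ + bipolarGauge ((setDynamics A B C)^[N * j] Set.univ) y := by
            rw [mul_add, mul_one, add_comm, Function.iterate_add_apply]
            exact steer _ (isCSet_iterate (N * j)) x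
        _ ≤ M * ‖x‖ + 2 * M * (1 / 2 * ‖x‖) := by
            gcongr
            exact (ih y).trans (by gcongr; exact halved x)
        _ = 2 * M * ‖x‖ := by ring
  refine ⟨2 * M, fun k x => (bipolarGauge_anti (isCSet_iterate (N * k)) ?_ x).trans (multiples k x)⟩
  exact antitone_iterate_setDynamics_univ (Nat.le_mul_of_pos_left k hN)

end ValueIteration

section FixedPoint

theorem image_iInter_of_antitone_of_isCompact {X Y : Type*} [TopologicalSpace X]
    [TopologicalSpace Y] [T2Space X] [T1Space Y] {f : X → Y} (hf : Continuous f)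
    {K : ℕ → Set X} (hanti : Antitone K) (hK : ∀ k, IsCompact (K k)) :
    f '' ⋂ k, K k = ⋂ k, f '' K k := by
  refine (Set.image_iInter_subset K f).antisymm fun y hy => ?_
  have hclosed : ∀ k, IsClosed (K k ∩ f ⁻¹' {y}) :=
    fun k => (hK k).isClosed.inter (isClosed_singleton.preimage hf)
  obtain ⟨x, hx⟩ := IsCompact.nonempty_iInter_of_sequence_nonempty_isCompact_isClosed
    (fun k => K k ∩ f ⁻¹' {y}) (fun k => Set.inter_subset_inter_left _ (hanti k.le_succ))
    (fun k => Set.mem_iInter.1 hy k) ((hK 0).inter_right (isClosed_singleton.preimage hf)) hclosed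
  have hx := Set.mem_iInter.1 hx
  exact ⟨x, Set.mem_iInter.2 fun k => (hx k).1, (hx 0).2⟩

theorem isProperCSet_iInter {ι : Type*} [Fintype ι] {J : Sort*} [Nonempty J]
    {I : J → Set (EuclideanSpace ℝ ι)} (hI : ∀ j, IsProperCSet (I j)) {M : ℝ}
    (hM : ∀ j x, gauge (I j) x ≤ M * ‖x‖) : IsProperCSet (⋂ j, I j) := by
  have hcompact : IsCompact (⋂ j, I j) :=
    (hI (Classical.arbitrary J)).1.1.of_isClosed_subset
      (isClosed_iInter fun j => (hI j).1.1.isClosed) (Set.iInter_subset I _)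
  refine IsCSet.isProperCSet
    ⟨hcompact, convex_iInter fun j => (hI j).1.2.1, Set.mem_iInter.2 fun j => (hI j).1.2.2⟩ ?_
  have hsmall : ∀ᶠ x : EuclideanSpace ℝ ι in 𝓝 0, M * ‖x‖ < 1 :=
    ContinuousAt.eventually_lt (by fun_prop) continuousAt_const (by simp)
  filter_upwards [hsmall] with x hx
  exact Set.mem_iInter.2 fun j => (hI j).gauge_le_one_iff.1 ((hM j x).trans hx.le)

variable {n m : ℕ} {A : Matrix (Fin n) (Fin n) ℝ} {B : Matrix (Fin n) (Fin m) ℝ}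
  {C : Set (EuclideanSpace ℝ (Fin n ⊕ Fin m))}

theorem jointPolar_iInter (hC : IsProperCSet C) {J : Sort*} [Nonempty J]
    {I : J → Set (EuclideanSpace ℝ (Fin n))} (hI : ∀ j, IsProperCSet (I j))
    (hInter : IsProperCSet (⋂ j, I j)) :
    jointPolar A B C (⋂ j, I j) = ⋂ j, jointPolar A B C (I j) := by
  refine Set.Subset.antisymm (Set.subset_iInter fun j => jointPolar_mono (Set.iInter_subset I j))
    fun p hp => ?_
  rw [← (isProperCSet_jointPolar hC hInter.polarSet.1).gauge_le_one_iff,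
    gauge_jointPolar hC hInter.polarSet.1, hInter.bipolarGauge_eq, ← le_sub_iff_add_le']
  refine gauge_iInter_le hI fun j => ?_
  have hpj := Set.mem_iInter.1 hp j
  rwa [← (isProperCSet_jointPolar hC (hI j).polarSet.1).gauge_le_one_iff,
    gauge_jointPolar hC (hI j).polarSet.1, (hI j).bipolarGauge_eq, ← le_sub_iff_add_le'] at hpj

theorem setDynamics_iInter (hC : IsProperCSet C) {I : ℕ → Set (EuclideanSpace ℝ (Fin n))}
    (hanti : Antitone I) (hI : ∀ k, IsProperCSet (I k)) (hInter : IsProperCSet (⋂ k, I k)) :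
    setDynamics A B C (⋂ k, I k) = ⋂ k, setDynamics A B C (I k) := by
  rw [setDynamics_eq_matImage_jointPolar, jointPolar_iInter hC hI hInter]
  exact image_iInter_of_antitone_of_isCompact (LinearMap.continuous_of_finiteDimensional _)
    (fun _ _ h => jointPolar_mono (hanti h))
    fun k => (isProperCSet_jointPolar hC (hI k).polarSet.1).1.1

theorem IsStrictlyStabilizable.exists_eq_setDynamics (hAB : IsStrictlyStabilizable A B)
    (hC : IsProperCSet C) :
    ∃ P : Set (EuclideanSpace ℝ (Fin n)), IsProperCSet P ∧ P = setDynamics A B C P := by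
  obtain ⟨M, hM⟩ := hAB.exists_bipolarGauge_iterate_univ_le hC
  let I : ℕ → Set (EuclideanSpace ℝ (Fin n)) := fun k => (setDynamics A B C)^[k + 1] Set.univ
  have hI : ∀ k, IsProperCSet (I k) :=
    isProperCSet_iterate_succ_setDynamics hC isCSet_polarSet_univ
  have hanti : Antitone I :=
    antitone_iterate_setDynamics_univ.comp_monotone (Order.succ_mono (α := ℕ))
  have hInter : IsProperCSet (⋂ k, I k) :=
    isProperCSet_iInter hI fun k => (hI k).bipolarGauge_eq ▸ hM (k + 1)
  have hsucc : ∀ k, setDynamics A B C (I k) = I (k + 1) :=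
    fun k => (Function.iterate_succ_apply' _ _ _).symm
  refine ⟨⋂ k, I k, hInter, ?_⟩
  rw [setDynamics_iInter hC hanti hI hInter]
  simp only [hsucc]
  exact (hanti.iInf_nat_add 1).symm

end FixedPoint

section RelativeError

variable {ι κ : Type*} [Fintype ι] [Fintype κ] {P Q : Set (EuclideanSpace ℝ ι)}

/-- The value function of `P` approximates that of `Q` up to a relative error of `ε`. This notion
of closeness, which is contracted by the set dynamics, also measures the distance to `Q` of the
unbounded states, whose Hausdorff distance to `Q` is infinite. -/
def IsGaugeApprox (Q : Set (EuclideanSpace ℝ ι)) (ε : ℝ) (P : Set (EuclideanSpace ℝ ι)) : Prop :=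
  ∀ x, |bipolarGauge P x - gauge Q x| ≤ ε * gauge Q x

theorem IsProperCSet.exists_isGaugeApprox (hQ : IsProperCSet Q) (hP : IsCSet (polarSet P)) :
    ∃ ε : ℝ, 0 ≤ ε ∧ IsGaugeApprox Q ε P := by
  obtain ⟨D, hD, hDQ⟩ := hQ.exists_gauge_map_le hP.polarSet_mem_nhds LinearMap.id
  refine ⟨D + 1, by positivity, fun x => ?_⟩
  have hle : bipolarGauge P x ≤ D * gauge Q x := hDQ x
  have h0P : 0 ≤ bipolarGauge P x := gauge_nonneg x
  have h0Q : 0 ≤ gauge Q x := gauge_nonneg x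
  rw [abs_le]
  constructor <;> nlinarith

protected theorem IsGaugeApprox.matImage [DecidableEq ι] (hP : IsProperCSet P) (hQ : IsProperCSet Q)
    {M : Matrix κ ι ℝ} (hM : Function.Surjective (Matrix.toEuclideanLin M)) {ε : ℝ}
    (h : IsGaugeApprox Q ε P) : IsGaugeApprox (matImage M Q) ε (matImage M P) := by
  intro y
  rw [(hP.matImage hM).bipolarGauge_eq]
  obtain ⟨⟨p, hp, hpP⟩, hminP⟩ := hP.isLeast_gauge_matImage hM y
  obtain ⟨⟨q, hq, hqQ⟩, hminQ⟩ := hQ.isLeast_gauge_matImage hM y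
  have hPq := hminP ⟨q, hq, rfl⟩
  have hQp := hminQ ⟨p, hp, rfl⟩
  have hap := abs_le.1 (hP.bipolarGauge_eq ▸ h p)
  have haq := abs_le.1 (hP.bipolarGauge_eq ▸ h q)
  have h0 : 0 ≤ gauge P p := gauge_nonneg p
  have h0' : 0 ≤ gauge Q q := gauge_nonneg q
  rw [← hpP, ← hqQ] at *
  rw [abs_le]
  refine ⟨?_, by linarith⟩
  rcases le_total ε 1 with hε | hε <;> nlinarith

theorem IsProperCSet.exists_mem_norm_sub_le (hQ : IsProperCSet Q) {c : ℝ} (hc : 0 ≤ c)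
    {x : EuclideanSpace ℝ ι} (hx : gauge Q x ≤ 1 + c) : ∃ y ∈ Q, ‖x - y‖ ≤ c * ‖x‖ := by
  have hc1 : 0 < 1 + c := by positivity
  refine ⟨(1 + c)⁻¹ • x, (hQ.gauge_le_iff hc1).1 hx, ?_⟩
  have hsub : x - (1 + c)⁻¹ • x = (c * (1 + c)⁻¹) • x := by
    rw [show c * (1 + c)⁻¹ = 1 - (1 + c)⁻¹ by field_simp; ring]
    module
  rw [hsub, norm_smul, Real.norm_of_nonneg (by positivity)]
  gcongr
  exact mul_le_of_le_one_right hc (inv_le_one_of_one_le₀ (le_add_of_nonneg_right hc))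

theorem IsProperCSet.exists_hausdorffEDist_le (hQ : IsProperCSet Q) :
    ∃ R : ℝ, 0 < R ∧ ∀ P, IsProperCSet P → ∀ ε : ℝ, 0 ≤ ε → ε ≤ 1 / 2 → IsGaugeApprox Q ε P →
      Metric.hausdorffEDist P Q ≤ ENNReal.ofReal (R * ε) := by
  obtain ⟨R, hR, hRQ⟩ := hQ.exists_norm_le
  refine ⟨4 * R, by positivity, fun P hP ε hε hε2 h => ?_⟩
  have happrox : ∀ x, (1 - ε) * gauge Q x ≤ gauge P x ∧ gauge P x ≤ (1 + ε) * gauge Q x :=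
    fun x => by
      have hx := abs_le.1 (hP.bipolarGauge_eq ▸ h x)
      constructor <;> linarith
  refine Metric.hausdorffEDist_le_of_mem_edist (fun x hx => ?_) (fun x hx => ?_)
  · have hle : (1 - ε) * gauge Q x ≤ 1 := (happrox x).1.trans (hP.gauge_le_one_iff.2 hx)
    have hgauge : gauge Q x ≤ 1 + 2 * ε := by nlinarith [gauge_nonneg (s := Q) x]
    obtain ⟨y, hy, hxy⟩ := hQ.exists_mem_norm_sub_le (by positivity) hgauge
    refine ⟨y, hy, edist_dist x y ▸ ENNReal.ofReal_le_ofReal ?_⟩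
    calc dist x y ≤ 2 * ε * ‖x‖ := (dist_eq_norm x y).trans_le hxy
      _ ≤ 2 * ε * (R * 2) := by gcongr; exact (hRQ x).trans (by gcongr; linarith)
      _ = 4 * R * ε := by ring
  · have hle : gauge Q x ≤ 1 := hQ.gauge_le_one_iff.2 hx
    have hgauge : gauge P x ≤ 1 + ε :=
      (happrox x).2.trans (mul_le_of_le_one_right (by positivity) hle)
    obtain ⟨y, hy, hxy⟩ := hP.exists_mem_norm_sub_le hε hgauge
    refine ⟨y, hy, edist_dist x y ▸ ENNReal.ofReal_le_ofReal ?_⟩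
    calc dist x y ≤ ε * ‖x‖ := (dist_eq_norm x y).trans_le hxy
      _ ≤ ε * (R * 1) := by gcongr; exact (hRQ x).trans (by gcongr)
      _ ≤ 4 * R * ε := by nlinarith [mul_nonneg hR.le hε]

theorem IsProperCSet.inner_le_of_exists_gauge_sub_le (hQ : IsProperCSet Q)
    {X Y : Set (EuclideanSpace ℝ ι)} {s : ℝ} (h : ∀ x ∈ X, ∃ y ∈ Y, gauge Q (x - y) ≤ s)
    {w x : EuclideanSpace ℝ ι} (hw : w ∈ polarSet Y) (hx : x ∈ X) :
    inner ℝ x w ≤ 1 + s * gauge (polarSet Q) w := by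
  obtain ⟨y, hy, hxy⟩ := h x hx
  calc inner ℝ x w = inner ℝ y w + inner ℝ (x - y) w := by rw [← inner_add_left, add_sub_cancel]
    _ ≤ 1 + gauge Q (x - y) * gauge (polarSet Q) w :=
      add_le_add (hw y hy) (hQ.inner_le_gauge_mul_gauge_polarSet _ _)
    _ ≤ 1 + s * gauge (polarSet Q) w := by gcongr; exact gauge_nonneg w

theorem IsProperCSet.isGaugeApprox_of_exists_gauge_sub_le (hQ : IsProperCSet Q)
    (hP : IsCSet (polarSet P)) {s : ℝ} (hs : 0 < s) (hs2 : s ≤ 1 / 2)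
    (hPQ : ∀ x ∈ P, ∃ y ∈ Q, gauge Q (x - y) ≤ s) (hQP : ∀ x ∈ Q, ∃ y ∈ P, gauge Q (x - y) ≤ s) :
    IsGaugeApprox Q (2 * s) P := by
  have lower : ∀ w ∈ polarSet Q, (1 + s)⁻¹ • w ∈ polarSet P := fun w hw x hx => by
    rw [inner_smul_right, inv_mul_le_iff₀ (by positivity), mul_one]
    refine (hQ.inner_le_of_exists_gauge_sub_le hPQ hw hx).trans ?_
    gcongr
    exact mul_le_of_le_one_right hs.le (gauge_le_one_of_mem hw)
  have upper : ∀ w ∈ polarSet P, (1 - s) • w ∈ polarSet Q := fun w hw x hx => by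
    have hgauge : gauge (polarSet Q) w ≤ 1 + s * gauge (polarSet Q) w :=
      hQ.1.gauge_polarSet_le_iff.2 fun y => hQ.inner_le_of_exists_gauge_sub_le hQP hw
    rw [inner_smul_right]
    nlinarith [hQ.1.inner_le_gauge_polarSet hx (x := w)]
  intro x
  have hle := hQ.polarSet.1.mul_gauge_polarSet_le hP (by positivity) lower x
  have hge := hP.mul_gauge_polarSet_le hQ.polarSet.1 (by linarith) upper x
  rw [hQ.1.polarSet_polarSet, ← bipolarGauge] at hle hge
  rw [inv_mul_le_iff₀ (by positivity)] at hle
  have h0Q : 0 ≤ gauge Q x := gauge_nonneg x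
  rw [abs_le]
  constructor <;> nlinarith

theorem IsProperCSet.exists_isGaugeApprox_of_hausdorffEDist_lt (hQ : IsProperCSet Q) {ε : ℝ}
    (hε : 0 < ε) (hε1 : ε ≤ 1) :
    ∃ δ : ℝ≥0∞, 0 < δ ∧ ∀ P, IsCSet (polarSet P) → Metric.hausdorffEDist P Q < δ →
      IsGaugeApprox Q ε P := by
  obtain ⟨K, hK, hKQ⟩ := exists_gauge_map_le_mul_norm hQ.mem_nhds LinearMap.id
  have hδ : 0 < ε / 2 / K := by positivity
  refine ⟨ENNReal.ofReal (ε / 2 / K), ENNReal.ofReal_pos.2 hδ, fun P hP hd => ?_⟩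
  have hclose : ∀ {X Y}, Metric.hausdorffEDist X Y < ENNReal.ofReal (ε / 2 / K) →
      ∀ x ∈ X, ∃ y ∈ Y, gauge Q (x - y) ≤ ε / 2 := fun hXY x hx => by
    obtain ⟨y, hy, hxy⟩ := Metric.exists_edist_lt_of_hausdorffEDist_lt hx hXY
    rw [edist_dist, ENNReal.ofReal_lt_ofReal_iff hδ, dist_eq_norm, lt_div_iff₀' hK] at hxy
    exact ⟨y, hy, (hKQ (x - y)).trans hxy.le⟩
  rw [← mul_div_cancel₀ ε two_ne_zero]
  exact hQ.isGaugeApprox_of_exists_gauge_sub_le hP (by positivity) (by linarith) (hclose hd)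
    (hclose (Metric.hausdorffEDist_comm.trans_lt hd))

end RelativeError

section Attractor

variable {n m : ℕ} {A : Matrix (Fin n) (Fin n) ℝ} {B : Matrix (Fin n) (Fin m) ℝ}
  {C : Set (EuclideanSpace ℝ (Fin n ⊕ Fin m))} {P Q : Set (EuclideanSpace ℝ (Fin n))}

theorem exists_isGaugeApprox_setDynamics (A : Matrix (Fin n) (Fin n) ℝ)
    (B : Matrix (Fin n) (Fin m) ℝ) (hC : IsProperCSet C) (hQ : IsProperCSet Q) :
    ∃ β : ℝ, 0 ≤ β ∧ β < 1 ∧ ∀ P, IsCSet (polarSet P) → ∀ ε : ℝ, 0 ≤ ε → IsGaugeApprox Q ε P →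
      IsGaugeApprox (setDynamics A B C Q) (β * ε) (setDynamics A B C P) := by
  obtain ⟨D, hD, hDC⟩ :=
    hC.exists_gauge_map_le hQ.mem_nhds (Matrix.toEuclideanLin (Matrix.fromCols A B))
  refine ⟨D / (1 + D), by positivity, by rw [div_lt_one] <;> linarith, fun P hP ε hε h => ?_⟩
  have hJP := isProperCSet_jointPolar (A := A) (B := B) hC hP
  have hJQ := isProperCSet_jointPolar (A := A) (B := B) hC hQ.polarSet.1
  refine IsGaugeApprox.matImage hJP hJQ surjective_toEuclideanLin_fromCols_one_zero fun p => ?_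
  rw [hJP.bipolarGauge_eq, gauge_jointPolar hC hP, gauge_jointPolar hC hQ.polarSet.1,
    hQ.bipolarGauge_eq, add_sub_add_left_eq_sub]
  set y := Matrix.toEuclideanLin (Matrix.fromCols A B) p
  -- only the part `V(Ax + Bu)` of the objective carries an error, and the stage cost dominates it
  have hfraction : gauge Q y ≤ D / (1 + D) * (gauge C p + gauge Q y) := by
    rw [div_mul_eq_mul_div, le_div_iff₀ (by positivity)]
    linarith [hDC p]
  calc |bipolarGauge P y - gauge Q y| ≤ ε * gauge Q y := h y
    _ ≤ ε * (D / (1 + D) * (gauge C p + gauge Q y)) := by gcongr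
    _ = D / (1 + D) * ε * (gauge C p + gauge Q y) := by ring

theorem exists_isGaugeApprox_iterate_setDynamics (hC : IsProperCSet C) (hQ : IsProperCSet Q)
    (hfix : Q = setDynamics A B C Q) :
    ∃ β : ℝ, 0 ≤ β ∧ β < 1 ∧ ∀ P, IsCSet (polarSet P) → ∀ ε : ℝ, 0 ≤ ε → IsGaugeApprox Q ε P →
      ∀ k, IsGaugeApprox Q (β ^ k * ε) ((setDynamics A B C)^[k] P) := by
  obtain ⟨β, hβ0, hβ1, hβ⟩ := exists_isGaugeApprox_setDynamics A B hC hQ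
  refine ⟨β, hβ0, hβ1, fun P hP ε hε h k => ?_⟩
  induction k with
  | zero => rwa [pow_zero, one_mul]
  | succ k ih =>
    have hstep := hβ _ (isCSet_polarSet_iterate_setDynamics hC hP k) _ (by positivity) ih
    rwa [← hfix, ← mul_assoc, ← pow_succ', ← Function.iterate_succ_apply' (setDynamics A B C)]
      at hstep

theorem tendsto_hausdorffEDist_iterate_setDynamics (hC : IsProperCSet C) (hQ : IsProperCSet Q)
    (hfix : Q = setDynamics A B C Q) (hP : IsCSet (polarSet P)) :
    Tendsto (fun k : ℕ => Metric.hausdorffEDist ((setDynamics A B C)^[k] P) Q) atTop (𝓝 0) := by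
  obtain ⟨β, hβ0, hβ1, hβ⟩ := exists_isGaugeApprox_iterate_setDynamics hC hQ hfix
  obtain ⟨ε, hε, hPQ⟩ := hQ.exists_isGaugeApprox hP
  obtain ⟨R, _, hdist⟩ := hQ.exists_hausdorffEDist_le
  have hpow : Tendsto (fun k : ℕ => β ^ k * ε) atTop (𝓝 0) := by
    simpa only [zero_mul] using (tendsto_pow_atTop_nhds_zero_of_lt_one hβ0 hβ1).mul_const ε
  have hlim : Tendsto (fun k : ℕ => ENNReal.ofReal (R * (β ^ k * ε))) atTop (𝓝 0) := by
    simpa only [mul_zero, ENNReal.ofReal_zero] using ENNReal.tendsto_ofReal (hpow.const_mul R)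
  refine tendsto_of_tendsto_of_tendsto_of_le_of_le' tendsto_const_nhds hlim
    (Eventually.of_forall fun _ => zero_le) ?_
  filter_upwards [hpow.eventually_le_const one_half_pos, eventually_ge_atTop 1] with k hk hk1
  obtain ⟨l, rfl⟩ := Nat.exists_eq_add_of_le' hk1
  exact hdist _ (isProperCSet_iterate_succ_setDynamics hC hP l) _ (by positivity) hk
    (hβ P hP ε hε hPQ (l + 1))

theorem exists_forall_hausdorffEDist_iterate_setDynamics_lt (hC : IsProperCSet C)
    (hQ : IsProperCSet Q) (hfix : Q = setDynamics A B C Q) {ε : ℝ≥0∞} (hε : 0 < ε) :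
    ∃ δ : ℝ≥0∞, 0 < δ ∧ ∀ P, IsCSet (polarSet P) → Metric.hausdorffEDist P Q < δ →
      ∀ k : ℕ, Metric.hausdorffEDist ((setDynamics A B C)^[k] P) Q < ε := by
  obtain ⟨β, hβ0, hβ1, hβ⟩ := exists_isGaugeApprox_iterate_setDynamics hC hQ hfix
  obtain ⟨R, hR, hdist⟩ := hQ.exists_hausdorffEDist_le
  have hlim : Tendsto (fun s : ℝ => ENNReal.ofReal (R * s)) (𝓝[>] 0) (𝓝 0) := by
    have hcont : Continuous fun s : ℝ => ENNReal.ofReal (R * s) :=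
      ENNReal.continuous_ofReal.comp (continuous_const_mul R)
    refine (hcont.tendsto' 0 0 ?_).mono_left nhdsWithin_le_nhds
    rw [mul_zero, ENNReal.ofReal_zero]
  obtain ⟨s, hsε, hs0, hs2⟩ := ((hlim.eventually_lt_const hε).and
    (Ioc_mem_nhdsGT (one_half_pos (α := ℝ)))).exists
  obtain ⟨δ, hδ, happrox⟩ :=
    hQ.exists_isGaugeApprox_of_hausdorffEDist_lt hs0 (hs2.trans one_half_lt_one.le)
  refine ⟨min δ ε, lt_min hδ hε, fun P hP hd k => ?_⟩
  cases k with
  | zero => exact hd.trans_le (min_le_right _ _)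
  | succ k =>
    have hle : β ^ (k + 1) * s ≤ s := mul_le_of_le_one_left hs0.le (pow_le_one₀ hβ0 hβ1.le)
    calc Metric.hausdorffEDist ((setDynamics A B C)^[k + 1] P) Q
        ≤ ENNReal.ofReal (R * (β ^ (k + 1) * s)) :=
          hdist _ (isProperCSet_iterate_succ_setDynamics hC hP k) _ (by positivity)
            (hle.trans hs2)
            (hβ P hP s hs0.le (happrox P hP (hd.trans_le (min_le_left _ _))) (k + 1))
      _ ≤ ENNReal.ofReal (R * s) := by gcongr
      _ < ε := hsε

theorem domainOfAttraction_setDynamics (hC : IsProperCSet C) (hQ : IsProperCSet Q)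
    (hfix : Q = setDynamics A B C Q) :
    domainOfAttraction (setDynamics A B C) (polarCSetStates n) Q = polarCSetStates n :=
  Set.Subset.antisymm (fun _ hP => hP.1)
    fun _ hP => ⟨hP, tendsto_hausdorffEDist_iterate_setDynamics hC hQ hfix hP.2⟩

theorem isAsymptoticallyStableAttractor_setDynamics (hC : IsProperCSet C) (hQ : IsProperCSet Q)
    (hfix : Q = setDynamics A B C Q) :
    IsAsymptoticallyStableAttractor (setDynamics A B C) (polarCSetStates n) Q := by
  refine ⟨fun ε hε => ?_, 1, one_pos, fun P hP _ => ?_⟩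
  · obtain ⟨δ, hδ, h⟩ := exists_forall_hausdorffEDist_iterate_setDynamics_lt hC hQ hfix hε
    exact ⟨δ, hδ, fun P hP => h P hP.2⟩
  · rwa [domainOfAttraction_setDynamics hC hQ hfix]

theorem image_polarSet_polarCSetStates (n : ℕ) : polarSet '' polarCSetStates n = {X | IsCSet X} :=
  Set.Subset.antisymm (Set.image_subset_iff.2 fun _ hP => hP.2) fun X (hX : IsCSet X) =>
    ⟨polarSet X, ⟨zero_mem_polarSet X, hX.polarSet_polarSet.symm ▸ hX⟩, hX.polarSet_polarSet⟩

theorem eq_of_eq_setDynamics (hC : IsProperCSet C) (hP : IsProperCSet P)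
    (hPfix : P = setDynamics A B C P) (hQ : IsProperCSet Q) (hQfix : Q = setDynamics A B C Q) :
    P = Q := by
  have h := tendsto_hausdorffEDist_iterate_setDynamics hC hQ hQfix hP.polarSet.1
  simp only [Function.iterate_fixed hPfix.symm] at h
  exact (hP.1.1.isClosed.hausdorffEDist_zero_iff hQ.1.1.isClosed).1
    (tendsto_nhds_unique tendsto_const_nhds h)

theorem eq_setDynamics_iff_isLeast (hC : IsProperCSet C) (hP : IsProperCSet P) :
    P = setDynamics A B C P ↔
      ∀ x, IsLeast (Set.range (bellmanObjective A B C (gauge P) x)) (gauge P x) := by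
  have hF := isLeast_gauge_setDynamics (A := A) (B := B) hC hP.polarSet.1
  rw [hP.bipolarGauge_eq] at hF
  refine ⟨fun h x => ?_, fun h => ?_⟩
  · have hx := hF x
    rwa [← h] at hx
  · exact hP.gauge_injective (isProperCSet_setDynamics hC hP.polarSet.1)
      (funext fun x => (h x).unique (hF x))

end Attractor

theorem theorem5p3 {n m : ℕ} (A : Matrix (Fin n) (Fin n) ℝ) (B : Matrix (Fin n) (Fin m) ℝ)
    (C : Set (EuclideanSpace ℝ (Fin n ⊕ Fin m)))
    (hAB : IsStrictlyStabilizable A B) (hC : IsProperCSet C) :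
    ∃ P : Set (EuclideanSpace ℝ (Fin n)),
      -- `P` is the unique proper `C`-set solving the fixed point set equation
      (IsProperCSet P ∧ P = setDynamics A B C P) ∧
      (∀ Q : Set (EuclideanSpace ℝ (Fin n)), IsProperCSet Q → Q = setDynamics A B C Q → Q = P) ∧
      -- the set dynamics is well posed and `P` is an asymptotically stable attractor for it
      (∀ P₀ ∈ polarCSetStates n, IsProperCSet (setDynamics A B C P₀)) ∧
      P ∈ polarCSetStates n ∧
      IsAsymptoticallyStableAttractor (setDynamics A B C) (polarCSetStates n) P ∧
      -- every state is attracted; in terms of polars, these are exactly the `C`-sets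
      domainOfAttraction (setDynamics A B C) (polarCSetStates n) P = polarCSetStates n ∧
      polarSet '' domainOfAttraction (setDynamics A B C) (polarCSetStates n) P =
        {Q : Set (EuclideanSpace ℝ (Fin n)) | IsCSet Q} ∧
      -- the Minkowski function of `P` is the unique fixed point value function
      (∃ U, IsMinkowskiBellmanFixedPoint A B C (gauge P) U) ∧
      (∀ V U, (∃ Q : Set (EuclideanSpace ℝ (Fin n)), IsProperCSet Q ∧ V = gauge Q) →
        IsMinkowskiBellmanFixedPoint A B C V U → V = gauge P) := by
  obtain ⟨P, hP, hfix⟩ := hAB.exists_eq_setDynamics hC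
  have hdomain := domainOfAttraction_setDynamics hC hP hfix
  refine ⟨P, ⟨hP, hfix⟩, fun Q hQ hQfix => eq_of_eq_setDynamics hC hQ hQfix hP hfix,
    fun P₀ hP₀ => isProperCSet_setDynamics hC hP₀.2, hP.mem_polarCSetStates,
    isAsymptoticallyStableAttractor_setDynamics hC hP hfix, hdomain, ?_,
    ⟨_, fun x => ⟨(eq_setDynamics_iff_isLeast hC hP).1 hfix x, rfl⟩⟩, ?_⟩
  · rw [hdomain, image_polarSet_polarCSetStates]
  · rintro _ U ⟨Q, hQ, rfl⟩ hU
    have hQfix := (eq_setDynamics_iff_isLeast hC hQ).2 fun x => (hU x).1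
    rw [eq_of_eq_setDynamics hC hQ hQfix hP hfix]
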